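/- A universe of separations is a finite lattice $(\vec U,\le,\vee,\wedge)$ with an order-reversing involution $\vec s\mapsto \vec s^{\,*}$; an unoriented separation is a pair $s=\{\vec s,\vec s^{\,*}\}$, the elements of $s$ are its orientations, and $U$ denotes the set of all unoriented separations. For $T\subseteq U$ let $\vec T$ be the set of all orientations of elements of $T$. Two unoriented separations $r,s$ are nested if they have orientations with $\vec r\le\vec s$, and $T$ is nested if its elements are pairwise nested. The universe is submodular if it comes with a function $|\cdot|\colon\vec U\to\mathbb N_0$ with $|\vec s|=|\vec s^{\,*}|$ and $|\vec s\vee\vec t\,|+|\vec s\wedge\vec t\,|\le|\vec s|+|\vec t\,|$ for all $\vec s,\vec t\in\vec U$, and distributive if its lattice is distributive. For $k\in\mathbb N_0$ let $\vec S_k=\{\vec s\in\vec U:|\vec s|<k\}$. A $k$-profile is a set $P\subseteq\vec S_k$ that - contains, for each $\vec s\in\vec S_k$, at least one of $\vec s,\vec s^{\,*}$, and contains both only if $\vec s=\vec s^{\,*}$; - is consistent: there are no $\vec r,\vec s\in P$ with $\vec r^{\,*}\le\vec s$ and $r\ne s$; and - satisfies $\vec r^{\,*}\wedge\vec s^{\,*}\notin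 P$ for all $\vec r,\vec s\in P$. A profile in $\vec U$ is a $k$-profile for some $k$. A profile $P$ is strongly robust if, for all $\vec s\in P$ and $\vec r\in\vec U$ with $|\vec s\vee\vec r\,|\le|\vec s|$ and $|\vec s\vee\vec r^{\,*}|\le|\vec s|$, at least one of $\vec s\vee\vec r$ and $\vec s\vee\vec r^{\,*}$ lies in $P$. An unoriented separation $s$ distinguishes $P$ and $Q$ if it has an orientation $\vec s$ with $\vec s\in P$ and $\vec s^{\,*}\in Q$. A set of profiles is distinguishable if every two distinct elements of it are distinguished by some $s\in U$. **Theorem (tree-of-tangles theorem for different orders).** Let $\vec U$ be a submodular distributive universe of separations. Then for every distinguishable set $\mathcal P$ of strongly robust profiles in $\vec U$ (possibly of different orders $k$) there is a nested set $T\subseteq U$ of separations such that 1. every two distinct profiles in $\mathcal P$ are distinguished by some separation in $T$; 2. for every $P\in\mathcal P$, every $\le$-maximal element $\vec s$ of $P\cap\vec T$ and every $\vec s{\,}'\in P$ with $\vec s\le\vec s{\,}'$, we have $|\vec s|\le|\vec s{\,}'|$. -/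

import Mathlib

namespace SeparationTheory

/-- A universe of separations: a lattice of oriented separations with an order-reversing
involution `s ↦ s⁻¹`, sending an oriented separation to its inverse. (Finiteness is added as the
instance `[Finite U]` where it is needed.) -/
class SeparationUniverse (U : Type*) extends Lattice U, InvolutiveInv U where
  inv_le_inv_of_le : ∀ {r s : U}, r ≤ s → s⁻¹ ≤ r⁻¹

variable {U : Type*} [SeparationUniverse U]

/-- The universe is distributive. -/
def IsDistributive (U : Type*) [SeparationUniverse U] : Prop :=
  ∀ r s t : U, r ⊔ (s ⊓ t) = (r ⊔ s) ⊓ (r ⊔ t)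

/-- A submodular order function on a universe of separations. -/
structure SubmodularOrder (U : Type*) [SeparationUniverse U] where
  order : U → ℕ
  order_inv : ∀ s : U, order s⁻¹ = order s
  submodular : ∀ s t : U, order (s ⊔ t) + order (s ⊓ t) ≤ order s + order t

/-- The oriented separations of order less than `k`. -/
def SubmodularOrder.below (ω : SubmodularOrder U) (k : ℕ) : Set U := {s | ω.order s < k}

/-- Unoriented separations: the pairs `{s, s⁻¹}`. -/
abbrev UnorientedSeparation (U : Type*) [SeparationUniverse U] : Type _ :=
  {p : Sym2 U // ∃ s : U, p = s(s, s⁻¹)}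

/-- The unoriented separation underlying an oriented separation. -/
def underlying (s : U) : UnorientedSeparation U := ⟨s(s, s⁻¹), s, rfl⟩

/-- All orientations of the elements of a set of unoriented separations. -/
def orientationsOf (T : Set (UnorientedSeparation U)) : Set U := {s | underlying s ∈ T}

/-- Two unoriented separations are nested if they have comparable orientations. -/
def Nested (r s : UnorientedSeparation U) : Prop :=
  ∃ r' s' : U, underlying r' = r ∧ underlying s' = s ∧ r' ≤ s'

/-- A set of unoriented separations is nested if its elements are pairwise nested. -/
def IsNestedSet (T : Set (UnorientedSeparation U)) : Prop :=
  ∀ r ∈ T, ∀ s ∈ T, Nested r s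

/-- `O` is an orientation of `S`, the set of oriented separations of a separation system: it
contains an orientation of each separation, and both `s` and `s⁻¹` only if these coincide. -/
structure IsOrientation (S O : Set U) : Prop where
  subset : O ⊆ S
  antisymmetric : ∀ s ∈ O, s⁻¹ ∈ O → s⁻¹ = s
  orients : ∀ s ∈ S, s ∈ O ∨ s⁻¹ ∈ O

/-- `O` contains no `r`, `s` with `r⁻¹ ≤ s` whose underlying separations are distinct. -/
def IsConsistent (O : Set U) : Prop :=
  ∀ r ∈ O, ∀ s ∈ O, r⁻¹ ≤ s → underlying r = underlying s

/-- A profile of `S`: a consistent orientation of `S` with the profile property. -/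
structure IsProfile (S P : Set U) : Prop where
  isOrientation : IsOrientation S P
  isConsistent : IsConsistent P
  profile_property : ∀ r ∈ P, ∀ s ∈ P, r⁻¹ ⊓ s⁻¹ ∉ P

/-- A profile in a submodular universe: a `k`-profile for some `k`. -/
def SubmodularOrder.IsProfileIn (ω : SubmodularOrder U) (P : Set U) : Prop :=
  ∃ k : ℕ, IsProfile (ω.below k) P

/-- Strong robustness. -/
def SubmodularOrder.IsStronglyRobust (ω : SubmodularOrder U) (P : Set U) : Prop :=
  ∀ s ∈ P, ∀ r : U, ω.order (s ⊔ r) ≤ ω.order s → ω.order (s ⊔ r⁻¹) ≤ ω.order s →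
    s ⊔ r ∈ P ∨ s ⊔ r⁻¹ ∈ P

/-- The unoriented separation `s` distinguishes `P` and `Q`. -/
def Distinguishes (s : UnorientedSeparation U) (P Q : Set U) : Prop :=
  ∃ s' : U, underlying s' = s ∧ s' ∈ P ∧ s'⁻¹ ∈ Q

/-- Some separation distinguishes `P` and `Q`. -/
def Distinguishable (P Q : Set U) : Prop :=
  ∃ s : UnorientedSeparation U, Distinguishes s P Q

end SeparationTheory

/-! ### Nested transversals of finite families. -/

namespace SeparationTheory

/-! Give each pair of distinct profiles the set of its distinguishers of minimum order. If two such
separations `r` (for `P`, `Q`) and `s` (for `P'`, `Q'`) cross and `|r| ≤ |s|`, then `r` or a corner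
of `r` and `s` is also optimal for `P'`, `Q'`, by submodularity and strong robustness
(`exists_corner_of_order_le`). A corner is nested with all that is nested with both `r` and `s`, so
`exists_nested_transversal` selects pairwise nested optimal distinguishers, which form `T`.

Any such `T` has the maximality property (`order_le_of_maximal`): let `s` be maximal in `P`, optimal
for `P'`, `Q`, with `s⁻¹ ∈ Q`. A cheaper `s' ≥ s` in `P` would distinguish `P` from `Q`, so `T`
would contain some `t` with `|t| < |s|` optimal for `P`, `Q`. Each way for `t` to be nested with `s`
is then impossible. -/

/-- Splinter lemma for a reflexive symmetric relation `N` of nestedness: a finite family of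
nonempty sets in which crossing elements have a corner in one of their sets has a nested
transversal. -/
theorem exists_nested_transversal {α ι : Type*} [Finite α] [Nonempty α] {N : α → α → Prop}
    (hrefl : ∀ x, N x x) (hsymm : ∀ x y, N x y → N y x) (I : Finset ι) (A : ι → Set α)
    (hne : ∀ i ∈ I, (A i).Nonempty)
    (hA : ∀ i ∈ I, ∀ j ∈ I, ∀ r ∈ A i, ∀ s ∈ A j, ¬ N r s → r ∈ A j ∨ s ∈ A i ∨
      ∃ c, (c ∈ A i ∨ c ∈ A j) ∧ N c r ∧ N c s ∧ ∀ t, N t r → N t s → N t c) :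
    ∃ a : ι → α, (∀ i ∈ I, a i ∈ A i) ∧ ∀ i ∈ I, ∀ j ∈ I, N (a i) (a j) := by
  classical
  induction I using Finset.induction_on generalizing A with
  | empty =>
    exact ⟨fun _ => Classical.arbitrary α, by simp, by simp⟩
  | insert n I hn ih =>
    obtain ⟨a, ha, hN⟩ := ih A (fun i hi => hne i (Finset.mem_insert_of_mem hi))
      (fun i hi j hj => hA i (Finset.mem_insert_of_mem hi) j (Finset.mem_insert_of_mem hj))
    have key : ∃ x ∈ A n, ∀ j ∈ I, ∃ y ∈ A j, N y x := by
      by_cases h : ∃ i ∈ I, a i ∈ A n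
      · obtain ⟨i, hi, hin⟩ := h
        exact ⟨a i, hin, fun j hj => ⟨a j, ha j hj, hN j hj i hi⟩⟩
      · push Not at h
        -- If `y` crosses `a j`, a corner in `A n` would be nested with `a j` as well as with every
        -- `a i` that `y` is nested with, against maximality. So the corner lies in `A j`.
        obtain ⟨y, hy, hmax⟩ := Set.exists_max_image (A n)
          (fun y => (I.filter fun i => N y (a i)).card) (Set.toFinite _)
          (hne n (Finset.mem_insert_self n I))
        refine ⟨y, hy, fun j hj => ?_⟩
        by_cases hyj : N y (a j)
        · exact ⟨a j, ha j hj, hsymm _ _ hyj⟩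
        rcases hA n (Finset.mem_insert_self n I) j (Finset.mem_insert_of_mem hj) y hy (a j)
          (ha j hj) hyj with h1 | h1 | ⟨c, h1 | h1, hcy, hcj, hc⟩
        · exact ⟨y, h1, hrefl y⟩
        · exact absurd h1 (h j hj)
        · refine absurd (hmax c h1) (not_le.2 (Finset.card_lt_card ?_))
          refine (Finset.ssubset_iff_of_subset fun i hi => ?_).2
            ⟨j, by simp [hj, hcj], by simp [hyj]⟩
          rw [Finset.mem_filter] at hi ⊢
          exact ⟨hi.1, hsymm _ _ (hc _ (hsymm _ _ hi.2) (hN i hi.1 j hj))⟩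
        · exact ⟨c, h1, hcy⟩
    obtain ⟨x, hx, hxN⟩ := key
    -- The hypothesis survives restriction to elements nested with `x`, since corners of such
    -- elements are again nested with `x`.
    obtain ⟨b, hb, hbN⟩ := ih (fun i => {y | y ∈ A i ∧ N y x})
      (fun i hi => let ⟨y, h1, h2⟩ := hxN i hi; ⟨y, h1, h2⟩)
      (fun i hi j hj r hr s hs hrs => by
        rcases hA i (Finset.mem_insert_of_mem hi) j (Finset.mem_insert_of_mem hj) r hr.1 s hs.1
          hrs with h | h | ⟨c, h, hcr, hcs, hc⟩
        · exact Or.inl ⟨h, hr.2⟩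
        · exact Or.inr (Or.inl ⟨h, hs.2⟩)
        · have hcx : N c x := hsymm _ _ (hc x (hsymm _ _ hr.2) (hsymm _ _ hs.2))
          exact Or.inr (Or.inr ⟨c, h.imp (⟨·, hcx⟩) (⟨·, hcx⟩), hcr, hcs, hc⟩))
    have hne' : ∀ i ∈ I, i ≠ n := fun i hi h => hn (h ▸ hi)
    refine ⟨Function.update b n x, fun i hi => ?_, fun i hi j hj => ?_⟩
    · rcases Finset.mem_insert.1 hi with rfl | hi'
      · simpa using hx
      · simpa [hne' i hi'] using (hb i hi').1
    · rcases Finset.mem_insert.1 hi with rfl | hi' <;> rcases Finset.mem_insert.1 hj with rfl | hj'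
      · exact hrefl _
      · simpa [hne' j hj'] using hsymm _ _ (hb j hj').2
      · simpa [hne' i hi'] using (hb i hi').2
      · simpa [hne' i hi', hne' j hj'] using hbN i hi' j hj'

/-! ### Involution, nestedness and corners. -/

variable {U : Type*} [SeparationUniverse U]

theorem inv_le_inv_iff' {r s : U} : r⁻¹ ≤ s⁻¹ ↔ s ≤ r :=
  ⟨fun h => by simpa using SeparationUniverse.inv_le_inv_of_le h,
    SeparationUniverse.inv_le_inv_of_le⟩

theorem inv_le_comm {r s : U} : r⁻¹ ≤ s ↔ s⁻¹ ≤ r := by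
  rw [← inv_le_inv_iff' (r := s), inv_inv]

theorem le_inv_comm {r s : U} : r ≤ s⁻¹ ↔ s ≤ r⁻¹ := by
  rw [← inv_le_inv_iff' (s := r), inv_inv]

theorem inv_sup (r s : U) : (r ⊔ s)⁻¹ = r⁻¹ ⊓ s⁻¹ := by
  apply le_antisymm
  · exact le_inf (inv_le_inv_iff'.2 le_sup_left) (inv_le_inv_iff'.2 le_sup_right)
  · rw [le_inv_comm]
    exact sup_le (le_inv_comm.1 inf_le_left) (le_inv_comm.1 inf_le_right)

theorem inv_inf (r s : U) : (r ⊓ s)⁻¹ = r⁻¹ ⊔ s⁻¹ := by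
  rw [← inv_inj, inv_sup, inv_inv, inv_inv, inv_inv]

theorem underlying_eq_iff {r s : U} : underlying r = underlying s ↔ r = s ∨ r = s⁻¹ := by
  constructor
  · intro h
    have h1 : s(r, r⁻¹) = s(s, s⁻¹) := congrArg Subtype.val h
    rw [Sym2.eq_iff] at h1
    exact h1.imp And.left And.left
  · rintro (rfl | rfl)
    · rfl
    · exact Subtype.ext (by simp [underlying, Sym2.eq_swap])

theorem nested_underlying_iff {r s : U} : Nested (underlying r) (underlying s) ↔
    r ≤ s ∨ r ≤ s⁻¹ ∨ r⁻¹ ≤ s ∨ r⁻¹ ≤ s⁻¹ := by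
  constructor
  · rintro ⟨r', s', hr, hs, h⟩
    rcases underlying_eq_iff.1 hr with rfl | rfl <;>
      rcases underlying_eq_iff.1 hs with rfl | rfl <;> simp [h]
  · have hi (x : U) : underlying x⁻¹ = underlying x := underlying_eq_iff.2 (Or.inr rfl)
    rintro (h | h | h | h)
    · exact ⟨_, _, rfl, rfl, h⟩
    · exact ⟨_, _, rfl, hi s, h⟩
    · exact ⟨_, _, hi r, rfl, h⟩
    · exact ⟨_, _, hi r, hi s, h⟩

/-- The separations underlying `r` and `s` are nested. -/
def OrientedNested (r s : U) : Prop := r ≤ s ∨ r ≤ s⁻¹ ∨ r⁻¹ ≤ s ∨ r⁻¹ ≤ s⁻¹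

theorem OrientedNested.symm {r s : U} (h : OrientedNested r s) : OrientedNested s r := by
  unfold OrientedNested at *
  rw [inv_le_inv_iff', le_inv_comm, inv_le_comm] at h
  rw [inv_le_inv_iff']
  tauto

theorem orientedNested_inv_left {r s : U} : OrientedNested r⁻¹ s ↔ OrientedNested r s := by
  unfold OrientedNested
  rw [inv_inv]
  tauto

theorem orientedNested_inv_right {r s : U} : OrientedNested r s⁻¹ ↔ OrientedNested r s := by
  unfold OrientedNested
  rw [inv_inv]
  tauto

/-- `c` is nested with `r`, with `s`, and with everything nested with both. -/
def IsNestedCorner (r s c : U) : Prop :=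
  OrientedNested c r ∧ OrientedNested c s ∧
    ∀ t, OrientedNested t r → OrientedNested t s → OrientedNested t c

theorem IsNestedCorner.symm {r s c : U} (h : IsNestedCorner r s c) : IsNestedCorner s r c :=
  ⟨h.2.1, h.1, fun t h1 h2 => h.2.2 t h2 h1⟩

theorem isNestedCorner_inv_left {r s c : U} :
    IsNestedCorner r⁻¹ s c ↔ IsNestedCorner r s c := by
  simp only [IsNestedCorner, orientedNested_inv_right]

theorem isNestedCorner_inv_right {r s c : U} :
    IsNestedCorner r s⁻¹ c ↔ IsNestedCorner r s c := by
  simp only [IsNestedCorner, orientedNested_inv_right]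

/-- The only ways for `t` to be nested with `r` and `s` but not visibly with `r ⊔ s` place `t`
between orientations of `r` and `s`, which would make these nested. -/
theorem isNestedCorner_sup {r s : U} (h : ¬ OrientedNested r s) :
    IsNestedCorner r s (r ⊔ s) := by
  refine ⟨OrientedNested.symm (Or.inl le_sup_left), OrientedNested.symm (Or.inl le_sup_right),
    fun t hr hs => ?_⟩
  rcases hr with hr | hr | hr | hr
  · exact Or.inl (hr.trans le_sup_left)
  · rcases hs with hs | hs | hs | hs
    · exact Or.inl (hs.trans le_sup_right)
    · exact Or.inr (Or.inl (by rw [inv_sup]; exact le_inf hr hs))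
    · exact Or.inr (Or.inr (Or.inl (hs.trans le_sup_right)))
    · exact absurd (Or.inr (Or.inl ((le_inv_comm.1 hr).trans hs))) h
  · exact Or.inr (Or.inr (Or.inl (hr.trans le_sup_left)))
  · rcases hs with hs | hs | hs | hs
    · exact Or.inl (hs.trans le_sup_right)
    · exact absurd (Or.inr (Or.inl ((inv_le_inv_iff'.1 hr).trans hs))) h
    · exact Or.inr (Or.inr (Or.inl (hs.trans le_sup_right)))
    · exact Or.inr (Or.inr (Or.inr (by rw [inv_sup]; exact le_inf hr hs)))

/-! ### Profiles and efficient distinguishers. -/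

section Profiles

variable {ω : SubmodularOrder U} {P Q P' Q' : Set U}

theorem SubmodularOrder.IsProfileIn.mem_or_inv_mem (hP : ω.IsProfileIn P) {s t : U} (hs : s ∈ P)
    (h : ω.order t ≤ ω.order s) : t ∈ P ∨ t⁻¹ ∈ P := by
  obtain ⟨k, hk⟩ := hP
  exact hk.isOrientation.orients t (lt_of_le_of_lt h (hk.isOrientation.subset hs))

theorem SubmodularOrder.IsProfileIn.isConsistent (hP : ω.IsProfileIn P) : IsConsistent P :=
  hP.choose_spec.isConsistent

/-- Here `u` only ensures that `P` orients `t`. The case `t = s⁻¹` is excluded because consistency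
ignores pairs with the same underlying separation. -/
theorem SubmodularOrder.IsProfileIn.mem_of_le (hP : ω.IsProfileIn P) {s t u : U} (hs : s ∈ P)
    (hu : u ∈ P) (hts : t ≤ s) (h : ω.order t ≤ ω.order u) (hne : t ≠ s⁻¹) : t ∈ P := by
  refine (hP.mem_or_inv_mem hu h).resolve_right fun ht => hne ?_
  have hc := hP.isConsistent t⁻¹ ht s hs (by rwa [inv_inv])
  rcases underlying_eq_iff.1 hc with h1 | h1
  · rw [← h1, inv_inv]
  · exact absurd (inv_inj.1 h1) fun h2 => hne (by
      subst h2
      exact (hP.choose_spec.isOrientation.antisymmetric t hs ht).symm)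

theorem SubmodularOrder.IsProfileIn.sup_mem (hP : ω.IsProfileIn P) {r s u : U} (hr : r ∈ P)
    (hs : s ∈ P) (hu : u ∈ P) (h : ω.order (r ⊔ s) ≤ ω.order u) : r ⊔ s ∈ P := by
  refine (hP.mem_or_inv_mem hu h).resolve_right fun hi => ?_
  rw [inv_sup] at hi
  exact hP.choose_spec.profile_property r hr s hs hi

/-- `s` distinguishes `P` from `Q`, and has minimum order with this property. -/
def SubmodularOrder.EfficientlyDistinguishes (ω : SubmodularOrder U) (s : U) (P Q : Set U) :
    Prop :=
  (s ∈ P ∧ s⁻¹ ∈ Q) ∧ ∀ t, t ∈ P → t⁻¹ ∈ Q → ω.order s ≤ ω.order t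

theorem SubmodularOrder.EfficientlyDistinguishes.inv {s : U}
    (h : ω.EfficientlyDistinguishes s P Q) : ω.EfficientlyDistinguishes s⁻¹ Q P := by
  refine ⟨⟨h.1.2, by simpa using h.1.1⟩, fun t ht ht' => ?_⟩
  rw [ω.order_inv, ← ω.order_inv t]
  exact h.2 _ ht' (by rwa [inv_inv])

/-- If neither `r ⊔ s` nor `r ⊔ s⁻¹` has order at most `|s|`, submodularity makes both opposite
corners cheaper than `r`. Strong robustness of `Q` at `r⁻¹` then makes one of them distinguish `P`
from `Q`, against the efficiency of `r`. -/
theorem exists_corner_of_mem (hP : ω.IsProfileIn P)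
    (hP' : ω.IsProfileIn P') (hQ' : ω.IsProfileIn Q') (hrob : ω.IsStronglyRobust Q) {r s : U}
    (hr : ω.EfficientlyDistinguishes r P Q) (hs : ω.EfficientlyDistinguishes s P' Q')
    (hrs : ¬ OrientedNested r s) (hrP' : r ∈ P') (hrQ' : r ∈ Q') :
    ∃ c, (ω.EfficientlyDistinguishes c P' Q' ∨ ω.EfficientlyDistinguishes c⁻¹ P' Q') ∧
      IsNestedCorner r s c := by
  have aux : ∀ {s P' Q'}, ω.IsProfileIn P' → ω.IsProfileIn Q' →
      ω.EfficientlyDistinguishes s P' Q' → ¬ OrientedNested r s → r ∈ P' →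
      ω.order (r ⊔ s) ≤ ω.order s → ω.EfficientlyDistinguishes (r ⊔ s) P' Q' := by
    intro s P' Q' hP' hQ' hs hrs hrP' h
    refine ⟨⟨hP'.sup_mem hrP' hs.1.1 hs.1.1 h, ?_⟩, fun t ht ht' => h.trans (hs.2 t ht ht')⟩
    refine hQ'.mem_of_le hs.1.2 hs.1.2 (inv_le_inv_iff'.2 le_sup_right)
      (by rwa [ω.order_inv, ω.order_inv]) fun he => hrs (Or.inr (Or.inl ?_))
    rw [inv_inv, inv_eq_iff_eq_inv] at he
    exact he ▸ le_sup_left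
  have hrs' : ¬ OrientedNested r s⁻¹ := fun h => hrs (orientedNested_inv_right.1 h)
  by_cases h1 : ω.order (r ⊔ s) ≤ ω.order s
  · exact ⟨_, Or.inl (aux hP' hQ' hs hrs hrP' h1), isNestedCorner_sup hrs⟩
  by_cases h2 : ω.order (r ⊔ s⁻¹) ≤ ω.order s⁻¹
  · exact ⟨_, Or.inr (aux hQ' hP' hs.inv hrs' hrQ' h2).inv,
      isNestedCorner_inv_right.1 (isNestedCorner_sup hrs')⟩
  exfalso
  have low : ∀ {s : U}, ¬ OrientedNested r s → r⁻¹ ⊔ s⁻¹ ∈ Q →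
      ω.order (r ⊔ s) ≤ ω.order s := by
    intro s hrs hQm
    by_contra hlt
    have hsub := ω.submodular r s
    have hlt' : ω.order (r ⊓ s) < ω.order r := by omega
    have hm : r ⊓ s ∈ P := hP.mem_of_le hr.1.1 hr.1.1 inf_le_left hlt'.le fun he =>
      hrs (Or.inr (Or.inr (Or.inl (he ▸ inf_le_right))))
    have := hr.2 _ hm (by rwa [inv_inf])
    omega
  have e1 : ω.order (r⁻¹ ⊔ s) ≤ ω.order r⁻¹ := by
    have := ω.submodular r s⁻¹
    rw [← inv_inv s, ← inv_inf, ω.order_inv, ω.order_inv]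
    rw [ω.order_inv] at this h2
    omega
  have e2 : ω.order (r⁻¹ ⊔ s⁻¹) ≤ ω.order r⁻¹ := by
    have := ω.submodular r s
    rw [← inv_inf, ω.order_inv, ω.order_inv]
    omega
  rcases hrob r⁻¹ hr.1.2 s e1 e2 with h | h
  · exact h2 (low hrs' (by rwa [inv_inv]))
  · exact h1 (low hrs h)

/-- As `|r| ≤ |s|`, both `P'` and `Q'` orient `r`. If they disagree, `r` is itself optimal for them;
if they agree, a corner is. -/
theorem exists_corner_of_order_le (hP : ω.IsProfileIn P) (hQ : ω.IsProfileIn Q)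
    (hP' : ω.IsProfileIn P') (hQ' : ω.IsProfileIn Q') (hrobP : ω.IsStronglyRobust P)
    (hrobQ : ω.IsStronglyRobust Q) {r s : U}
    (hr : ω.EfficientlyDistinguishes r P Q) (hs : ω.EfficientlyDistinguishes s P' Q')
    (hrs : ¬ OrientedNested r s) (hle : ω.order r ≤ ω.order s) :
    (ω.EfficientlyDistinguishes r P' Q' ∨ ω.EfficientlyDistinguishes r⁻¹ P' Q') ∨
    ∃ c, (ω.EfficientlyDistinguishes c P' Q' ∨ ω.EfficientlyDistinguishes c⁻¹ P' Q') ∧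
      IsNestedCorner r s c := by
  have hle' : ω.order r⁻¹ ≤ ω.order s := by rwa [ω.order_inv]
  rcases hP'.mem_or_inv_mem hs.1.1 hle with h1 | h1 <;>
    rcases hQ'.mem_or_inv_mem hs.1.2 (hle.trans_eq (ω.order_inv s).symm) with h2 | h2
  · exact Or.inr (exists_corner_of_mem hP hP' hQ' hrobQ hr hs hrs h1 h2)
  · exact Or.inl (Or.inl ⟨⟨h1, h2⟩, fun t ht ht' => hle.trans (hs.2 t ht ht')⟩)
  · exact Or.inl (Or.inr ⟨⟨h1, by rwa [inv_inv]⟩, fun t ht ht' => hle'.trans (hs.2 t ht ht')⟩)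
  · obtain ⟨c, hc, hc'⟩ := exists_corner_of_mem hQ hP' hQ' hrobP hr.inv hs
      (fun h => hrs (orientedNested_inv_left.1 h)) h1 h2
    exact Or.inr ⟨c, hc, isNestedCorner_inv_left.1 hc'⟩

/-! ### The nested set and its maximal elements. -/

/-- A nested choice of efficient distinguishers for all pairs of profiles. -/
theorem exists_nested_efficientlyDistinguishes [Finite U] {Ps : Set (Set U)}
    (hprofile : ∀ P ∈ Ps, ω.IsProfileIn P) (hrobust : ∀ P ∈ Ps, ω.IsStronglyRobust P)
    (hdist : ∀ P ∈ Ps, ∀ Q ∈ Ps, P ≠ Q → Distinguishable P Q) :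
    ∃ B : Set U, (∀ r ∈ B, ∀ s ∈ B, OrientedNested r s) ∧
      (∀ P ∈ Ps, ∀ Q ∈ Ps, P ≠ Q → ∃ s ∈ B,
        ω.EfficientlyDistinguishes s P Q ∨ ω.EfficientlyDistinguishes s⁻¹ P Q) ∧
      ∀ s ∈ B, ∃ P ∈ Ps, ∃ Q ∈ Ps,
        ω.EfficientlyDistinguishes s P Q ∨ ω.EfficientlyDistinguishes s⁻¹ P Q := by
  classical
  rcases isEmpty_or_nonempty U with hU | hU
  · refine ⟨∅, by simp, fun P hP Q hQ h => ?_, by simp⟩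
    exact absurd (Subsingleton.elim P Q) h
  let I : Finset (Set U × Set U) := (Set.toFinite {p | p.1 ∈ Ps ∧ p.2 ∈ Ps ∧ p.1 ≠ p.2}).toFinset
  have hI (p) : p ∈ I ↔ p.1 ∈ Ps ∧ p.2 ∈ Ps ∧ p.1 ≠ p.2 := by simp [I]
  obtain ⟨a, ha, hN⟩ := exists_nested_transversal (N := OrientedNested (U := U))
    (fun _ => Or.inl le_rfl) (fun _ _ => OrientedNested.symm) I
    (fun p => {s | ω.EfficientlyDistinguishes s p.1 p.2 ∨
      ω.EfficientlyDistinguishes s⁻¹ p.1 p.2})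
    (fun p hp => by
      obtain ⟨h1, h2, h3⟩ := (hI p).1 hp
      obtain ⟨_, s, -, hs⟩ := hdist _ h1 _ h2 h3
      obtain ⟨m, hm, hmin⟩ := Set.exists_min_image {s | s ∈ p.1 ∧ s⁻¹ ∈ p.2} ω.order
        (Set.toFinite _) ⟨s, hs⟩
      exact ⟨m, Or.inl ⟨hm, fun t ht ht' => hmin t ⟨ht, ht'⟩⟩⟩)
    (fun p hp q hq => by
      -- By symmetry the separation of smaller order may be called `r`.
      suffices H : ∀ p ∈ I, ∀ q ∈ I, ∀ r s,
          (ω.EfficientlyDistinguishes r p.1 p.2 ∨ ω.EfficientlyDistinguishes r⁻¹ p.1 p.2) →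
          (ω.EfficientlyDistinguishes s q.1 q.2 ∨ ω.EfficientlyDistinguishes s⁻¹ q.1 q.2) →
          ¬ OrientedNested r s → ω.order r ≤ ω.order s →
          (ω.EfficientlyDistinguishes r q.1 q.2 ∨ ω.EfficientlyDistinguishes r⁻¹ q.1 q.2) ∨
          ∃ c, (ω.EfficientlyDistinguishes c q.1 q.2 ∨
            ω.EfficientlyDistinguishes c⁻¹ q.1 q.2) ∧ IsNestedCorner r s c by
        intro r hr s hs hrs
        rcases le_total (ω.order r) (ω.order s) with hle | hle
        · rcases H p hp q hq r s hr hs hrs hle with h | ⟨c, h, hc⟩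
          · exact Or.inl h
          · exact Or.inr (Or.inr ⟨c, Or.inr h, hc⟩)
        · rcases H q hq p hp s r hs hr (fun h => hrs h.symm) hle with h | ⟨c, h, hc⟩
          · exact Or.inr (Or.inl h)
          · exact Or.inr (Or.inr ⟨c, Or.inl h, hc.symm⟩)
      clear hp hq p q
      intro p hp q hq r s hr hs hrs hle
      obtain ⟨h1, h2, -⟩ := (hI p).1 hp
      obtain ⟨h3, h4, -⟩ := (hI q).1 hq
      have key := @exists_corner_of_order_le U _ ω p.1 p.2 q.1 q.2 (hprofile _ h1)
        (hprofile _ h2) (hprofile _ h3) (hprofile _ h4) (hrobust _ h1) (hrobust _ h2)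
      rcases hr with hr | hr <;> rcases hs with hs | hs
      · exact key hr hs hrs hle
      · simpa only [isNestedCorner_inv_right] using
          key hr hs (by rwa [orientedNested_inv_right]) (by rwa [ω.order_inv])
      · simpa only [isNestedCorner_inv_left, inv_inv, or_comm] using
          key hr hs (by rwa [orientedNested_inv_left]) (by rwa [ω.order_inv])
      · simpa only [isNestedCorner_inv_left, isNestedCorner_inv_right, inv_inv, or_comm] using
          key hr hs (by rwa [orientedNested_inv_left, orientedNested_inv_right])
            (by rwa [ω.order_inv, ω.order_inv]))
  refine ⟨a '' I, ?_, fun P hP Q hQ h => ?_, ?_⟩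
  · rintro _ ⟨p, hp, rfl⟩ _ ⟨q, hq, rfl⟩
    exact hN p hp q hq
  · have hm : (P, Q) ∈ I := (hI _).2 ⟨hP, hQ, h⟩
    exact ⟨a (P, Q), ⟨_, hm, rfl⟩, ha _ hm⟩
  · rintro _ ⟨p, hp, rfl⟩
    obtain ⟨h1, h2, -⟩ := (hI p).1 hp
    exact ⟨_, h1, _, h2, ha p hp⟩

/-- An element of a nested set of efficient distinguishers that distinguishes `P'` from `Q`
efficiently and is maximal in `P` has least order among the elements of `P` above it, provided
that the nested set contains an efficient distinguisher of `P` and `Q`. -/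
theorem order_le_of_maximal (hP : ω.IsProfileIn P) (hP' : ω.IsProfileIn P')
    (hQ : ω.IsProfileIn Q) {s s' : U} (hs : ω.EfficientlyDistinguishes s P' Q) (hsP : s ∈ P)
    (hs' : s' ∈ P) (hss' : s ≤ s')
    (ht : P ≠ Q → ∃ t, ω.EfficientlyDistinguishes t P Q ∧ OrientedNested t s ∧
      (s ≤ t → t ≤ s)) : ω.order s ≤ ω.order s' := by
  by_contra! hlt
  have hne : ∀ {x y : U}, ω.order x < ω.order y → underlying x ≠ underlying y := by
    intro x y hxy h
    rcases underlying_eq_iff.1 h with rfl | rfl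
    · exact hxy.ne rfl
    · exact hxy.ne (ω.order_inv y)
  have hinv : ∀ x : U, underlying x⁻¹ = underlying x := fun x => underlying_eq_iff.2 (Or.inr rfl)
  by_cases hPQ : P = Q
  · subst hPQ
    exact hne hlt (hP.isConsistent _ hs.1.2 _ hs' (by rwa [inv_inv]) ▸ hinv s)
  obtain ⟨t, ht, hts, hmax⟩ := ht hPQ
  have hsQ : s'⁻¹ ∈ Q := hQ.mem_of_le hs.1.2 hs.1.2 (inv_le_inv_iff'.2 hss')
    (by rw [ω.order_inv, ω.order_inv]; exact hlt.le) fun h => hne hlt (by rw [← hinv s', h, inv_inv])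
  have hlt' : ω.order t < ω.order s := (ht.2 s' hs' hsQ).trans_lt hlt
  -- The four cases contradict, in turn, efficiency of `s`, consistency of `Q`, consistency of `P`,
  -- and maximality of `s`.
  rcases hts with h | h | h | h
  · have htP' : t ∈ P' := hP'.mem_of_le hs.1.1 hs.1.1 h hlt'.le fun h =>
      hne hlt' (by rw [h, hinv])
    exact absurd (hs.2 t htP' ht.1.2) (not_le.2 hlt')
  · refine hne hlt' ?_
    rw [← hinv t, ← hinv s]
    exact hQ.isConsistent _ ht.1.2 _ hs.1.2 (by rwa [inv_inv])
  · exact hne hlt' (hP.isConsistent _ ht.1.1 _ hsP h)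
  · have hst := inv_le_inv_iff'.1 h
    exact hlt'.ne (congrArg ω.order (le_antisymm (hmax hst) hst))

end Profiles

end SeparationTheory

theorem mainTheorem5 {U : Type*} [SeparationTheory.SeparationUniverse U] [Finite U]
    (hU : SeparationTheory.IsDistributive U)
    (ω : SeparationTheory.SubmodularOrder U)
    (Ps : Set (Set U))
    (hprofile : ∀ P ∈ Ps, ω.IsProfileIn P)
    (hrobust : ∀ P ∈ Ps, ω.IsStronglyRobust P)
    (hdist : ∀ P ∈ Ps, ∀ Q ∈ Ps, P ≠ Q → SeparationTheory.Distinguishable P Q) :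
    ∃ T : Set (SeparationTheory.UnorientedSeparation U),
      SeparationTheory.IsNestedSet T ∧
      (∀ P ∈ Ps, ∀ Q ∈ Ps, P ≠ Q → ∃ s ∈ T, SeparationTheory.Distinguishes s P Q) ∧
      (∀ P ∈ Ps, ∀ s : U, Maximal (fun x => x ∈ P ∩ SeparationTheory.orientationsOf T) s →
        ∀ s' ∈ P, s ≤ s' → ω.order s ≤ ω.order s') := by
  open SeparationTheory in
  obtain ⟨B, hB, hPQ, hex⟩ := exists_nested_efficientlyDistinguishes hprofile hrobust hdist
  have hinv (x : U) : underlying x⁻¹ = underlying x := underlying_eq_iff.2 (Or.inr rfl)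
  have hnest {x y : U} (hx : underlying x ∈ underlying '' B) (hy : underlying y ∈ underlying '' B) :
      OrientedNested x y := by
    obtain ⟨r, hr, hrx⟩ := hx
    obtain ⟨s, hs, hsy⟩ := hy
    have := nested_underlying_iff.2 (hB r hr s hs)
    rw [hrx, hsy] at this
    exact nested_underlying_iff.1 this
  have hEff {P Q : Set U} (hP : P ∈ Ps) (hQ : Q ∈ Ps) (h : P ≠ Q) :
      ∃ t, underlying t ∈ underlying '' B ∧ ω.EfficientlyDistinguishes t P Q := by
    obtain ⟨t, ht, h | h⟩ := hPQ P hP Q hQ h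
    · exact ⟨t, ⟨t, ht, rfl⟩, h⟩
    · exact ⟨t⁻¹, ⟨t, ht, (hinv t).symm⟩, h⟩
  refine ⟨underlying '' B, ?_, fun P hP Q hQ h => ?_, fun P hP s hs s' hs' hss' => ?_⟩
  · rintro _ ⟨r, hr, rfl⟩ _ ⟨s, hs, rfl⟩
    exact nested_underlying_iff.2 (hB r hr s hs)
  · obtain ⟨t, ht, h⟩ := hEff hP hQ h
    exact ⟨_, ht, t, rfl, h.1⟩
  · have hsT : underlying s ∈ underlying '' B := hs.prop.2
    -- Swapping the two profiles if necessary fits the pair to the orientation `s`.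
    have hs2 : ∃ P' ∈ Ps, ∃ Q ∈ Ps, ω.EfficientlyDistinguishes s P' Q := by
      obtain ⟨b, hb, hbs⟩ := hsT
      obtain ⟨P', hP', Q, hQ, h⟩ := hex b hb
      rcases underlying_eq_iff.1 hbs with rfl | rfl
      · exact h.elim (fun h => ⟨_, hP', _, hQ, h⟩)
          fun h => ⟨_, hQ, _, hP', by simpa using h.inv⟩
      · exact h.elim (fun h => ⟨_, hQ, _, hP', by simpa using h.inv⟩)
          fun h => ⟨_, hP', _, hQ, by simpa using h⟩
    obtain ⟨P', hP', Q, hQ, hsE⟩ := hs2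
    refine order_le_of_maximal (hprofile P hP) (hprofile P' hP') (hprofile Q hQ) hsE hs.prop.1
      hs' hss' fun hne => ?_
    obtain ⟨t, ht, h⟩ := hEff hP hQ hne
    exact ⟨t, h, hnest ht hsT, hs.le_of_ge ⟨h.1.1, ht⟩⟩
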